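/- Let $\mathbb{R}^3_1$ be $\mathbb{R}^3$ with the Lorentzian metric $\langle\,,\rangle=dx_1^2+dx_2^2-dx_3^2$. Let $\mathcal{M}$ be a Riemann surface with non-empty boundary, that is, a closed subset of a connected Riemann surface $\mathcal{M}'$ together with a non-empty closed subset $\partial\mathcal{M}\subseteq\mathcal{M}$ that contains the topological frontier of $\mathcal{M}$ in $\mathcal{M}'$ (for instance, a locally finite family of pairwise disjoint closed curves, some of which may be single points); put $\mathrm{Int}(\mathcal{M})=\mathcal{M}\setminus\partial\mathcal{M}$. Let $X:\mathcal{M}\to\mathbb{R}^3_1$ be a conformal maximal immersion, that is, a continuous map which on $\mathrm{Int}(\mathcal{M})$ is smooth, conformal and spacelike (the induced metric is Riemannian) and has zero mean curvature; it may be singular at boundary points. Suppose that the Lorentzian norm $$n:\mathcal{M}\to\mathbb{R},\qquad n(p)=\langle X(p),X(p)\rangle,$$ is positive outside a compact subset of $\mathcal{M}$ and is proper. Then $\mathcal{M}$ is relative parabolic: every bounded continuous function $f:\mathcal{M}\to\mathbb{R}$ that is harmonic on $\mathrm{Int}(\mathcal{M})$ and vanishes on $\partial\mathcal{M}$ is identically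 zero. -/

import Mathlib

open scoped Manifold ContDiff

noncomputable section

namespace LorentzSurface

/-! ### The Lorentz-Minkowski space `ℝ³₁` -/

/-- The Lorentzian metric `dx₁² + dx₂² - dx₃²` on `ℝ³`. -/
def lorentz (x y : Fin 3 → ℝ) : ℝ :=
  x 0 * y 0 + x 1 * y 1 - x 2 * y 2

/-- The Lorentzian cross product, characterized by `⟨x × y, w⟩ = det (x, y, w)`. In particular
`x × y` is Lorentz-orthogonal to `x` and to `y`. -/
def lorentzCross (x y : Fin 3 → ℝ) : Fin 3 → ℝ :=
  ![x 1 * y 2 - x 2 * y 1, x 2 * y 0 - x 0 * y 2, -(x 0 * y 1 - x 1 * y 0)]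

/-! ### Local theory of a parametrized surface `Y(u, v)`, with `z = u + i v` -/

/-- The partial derivative `∂/∂u`. -/
def dU (Y : ℂ → Fin 3 → ℝ) (z : ℂ) : Fin 3 → ℝ := fderiv ℝ Y z 1

/-- The partial derivative `∂/∂v`. -/
def dV (Y : ℂ → Fin 3 → ℝ) (z : ℂ) : Fin 3 → ℝ := fderiv ℝ Y z Complex.I

/-- The tangent plane of `Y` at `z` is spacelike: the induced metric is positive definite there
(in particular `Y` is an immersion at `z`). -/
def SpacelikeAt (Y : ℂ → Fin 3 → ℝ) (z : ℂ) : Prop :=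
  ∀ w : ℂ, w ≠ 0 → 0 < lorentz (fderiv ℝ Y z w) (fderiv ℝ Y z w)

/-- `z = u + i v` is an isothermal parameter for `Y` at `z`. -/
def IsothermalAt (Y : ℂ → Fin 3 → ℝ) (z : ℂ) : Prop :=
  lorentz (dU Y z) (dU Y z) = lorentz (dV Y z) (dV Y z) ∧ lorentz (dU Y z) (dV Y z) = 0

/-- The determinant `E G - F²` of the first fundamental form. -/
def firstDet (Y : ℂ → Fin 3 → ℝ) (z : ℂ) : ℝ :=
  lorentz (dU Y z) (dU Y z) * lorentz (dV Y z) (dV Y z) - lorentz (dU Y z) (dV Y z) ^ 2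

/-- The timelike unit normal `N = (Y_u × Y_v) / √(E G - F²)` (Gauss map) of a spacelike `Y`. -/
def unitNormal (Y : ℂ → Fin 3 → ℝ) (z : ℂ) : Fin 3 → ℝ :=
  (Real.sqrt (firstDet Y z))⁻¹ • lorentzCross (dU Y z) (dV Y z)

/-- The mean curvature `(e G - 2 f F + g E) / (2 (E G - F²))` of a spacelike `Y`, where
`e = ⟨Y_uu, N⟩`, `f = ⟨Y_uv, N⟩`, `g = ⟨Y_vv, N⟩`. -/
def meanCurvature (Y : ℂ → Fin 3 → ℝ) (z : ℂ) : ℝ :=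
  (lorentz (dU (dU Y) z) (unitNormal Y z) * lorentz (dV Y z) (dV Y z)
      - 2 * lorentz (dV (dU Y) z) (unitNormal Y z) * lorentz (dU Y z) (dV Y z)
      + lorentz (dV (dV Y) z) (unitNormal Y z) * lorentz (dU Y z) (dU Y z))
    / (2 * firstDet Y z)

/-! ### Riemann surfaces with boundary inside an ambient Riemann surface `S` -/

variable {S : Type*} [TopologicalSpace S]

/-- `M` is a closed region of the surface `S`, with boundary `bd`: a closed subset of `M` that
contains the topological frontier of `M`. The interior of the surface is then the open set
`M \ bd`. This covers a frontier made of a locally finite family of disjoint closed curves, and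
isolated boundary points around which `M` is a full neighbourhood (branch points); no regularity
of the boundary is imposed. -/
structure IsSurfaceWithBoundary (M bd : Set S) : Prop where
  isClosed : IsClosed M
  isClosed_bd : IsClosed bd
  bd_subset : bd ⊆ M
  frontier_subset : frontier M ⊆ bd

variable [ChartedSpace ℂ S]

/-- `f` is harmonic on the open subset `U` of the Riemann surface `S`: it is harmonic when it is
read in any holomorphic coordinate of the atlas. -/
def HarmonicOn (f : S → ℝ) (U : Set S) : Prop :=
  ∀ φ ∈ atlas ℂ S,
    InnerProductSpace.HarmonicOnNhd (f ∘ φ.symm) (φ.target ∩ φ.symm ⁻¹' U)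

/-- A Riemann surface `M` with boundary `bd` is relative parabolic if the only bounded harmonic
function (continuous up to the boundary) that vanishes on the boundary is the zero function. -/
def RelativeParabolic (M bd : Set S) : Prop :=
  ∀ f : S → ℝ, ContinuousOn f M → HarmonicOn f (M \ bd) →
    (∃ C : ℝ, ∀ p ∈ M, |f p| ≤ C) → (∀ p ∈ bd, f p = 0) → ∀ p ∈ M, f p = 0

/-- `X` is a conformal maximal immersion of the Riemann surface `M` with boundary `bd` in `ℝ³₁`: it
is continuous on `M` and, on the interior `M \ bd`, it is smooth, spacelike, conformal and of zero
mean curvature. It may be singular at boundary points. -/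
structure IsConformalMaximalImmersion (M bd : Set S) (X : S → Fin 3 → ℝ) : Prop where
  continuousOn : ContinuousOn X M
  smooth : ∀ φ ∈ atlas ℂ S, ContDiffOn ℝ ∞ (X ∘ φ.symm) (φ.target ∩ φ.symm ⁻¹' (M \ bd))
  spacelike : ∀ φ ∈ atlas ℂ S, ∀ z ∈ φ.target ∩ φ.symm ⁻¹' (M \ bd), SpacelikeAt (X ∘ φ.symm) z
  conformal : ∀ φ ∈ atlas ℂ S, ∀ z ∈ φ.target ∩ φ.symm ⁻¹' (M \ bd), IsothermalAt (X ∘ φ.symm) z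
  maximal : ∀ φ ∈ atlas ℂ S, ∀ z ∈ φ.target ∩ φ.symm ⁻¹' (M \ bd),
    meanCurvature (X ∘ φ.symm) z = 0

/-- The Lorentzian norm `n(p) = ⟨X(p), X(p)⟩`. -/
def lorentzNorm (X : S → Fin 3 → ℝ) (p : S) : ℝ := lorentz (X p) (X p)

end LorentzSurface

end

open scoped Topology
open Filter Set

namespace LorentzSurface

/-! The barrier is `log (n - 1)` on `n > 1`. In a chart a conformal maximal `Y` has harmonic
coordinates (`laplacian_eq_zero`), so with conformal factor `l` one gets `Δn = 4 l`. The normal part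
of `Y` is timelike, so `|∇n|² ≥ 4 l n`. Hence `Δ log (n - 1) ≤ 4 l / (n - 1) - 4 l n / (n - 1)² <
0`, and `f - ε log (n - 1)` has no interior local maximum (`not_isLocalMax_sub_log`).

Properness makes `n ≤ R` compact. Comparison on `2 ≤ n ≤ R` with `R` large, then `ε → 0`, bounds `f`
by its values on `n ≤ 2` (`le_of_le_on_sublevel`). A positive supremum would therefore be attained,
which the strong maximum principle, connectedness and the non-empty boundary forbid. The same
argument for `-f` gives `f = 0`. -/

/-! ### Calculus along lines -/

/-- Second order necessary condition at a local maximum of a function of one variable. -/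
lemma second_deriv_nonpos_of_isLocalMax {g g' : ℝ → ℝ} {c t : ℝ}
    (hg : ∀ᶠ s in 𝓝 t, HasDerivAt g (g' s) s) (hg' : HasDerivAt g' c t)
    (hmax : IsLocalMax g t) : c ≤ 0 := by
  by_contra! hc
  have hd : deriv g =ᶠ[𝓝 t] g' := hg.mono fun s hs => hs.deriv
  have hdd : deriv (deriv g) t = c := hd.deriv_eq.trans hg'.deriv
  -- If `c > 0`, the second derivative test makes `t` a local minimum as well, so `g` is locally
  -- constant and `c = 0`.
  have hmin : IsLocalMin g t :=
    isLocalMin_of_deriv_deriv_pos (hdd ▸ hc) hmax.deriv_eq_zero hg.self_of_nhds.continuousAt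
  have hconst : g =ᶠ[𝓝 t] fun _ => g t := by
    filter_upwards [hmax, hmin] with s h₁ h₂ using le_antisymm h₁ h₂
  have hzero : deriv g =ᶠ[𝓝 t] fun _ => 0 := by
    filter_upwards [hconst.eventuallyEq_nhds] with s hs
    rw [hs.deriv_eq, deriv_const]
  rw [hzero.deriv_eq, deriv_const] at hdd
  exact hc.ne hdd

lemma hasDerivAt_line {F : Type*} [NormedAddCommGroup F] [NormedSpace ℝ F] {h : ℂ → F}
    {z w : ℂ} {t : ℝ} (hh : DifferentiableAt ℝ h (z + t • w)) :
    HasDerivAt (fun s : ℝ => h (z + s • w)) (fderiv ℝ h (z + t • w) w) t := by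
  have h1 : HasDerivAt (fun s : ℝ => z + s • w) w t := by
    simpa using ((hasDerivAt_id t).smul_const w).const_add z
  exact hh.hasFDerivAt.comp_hasDerivAt t h1

lemma hasDerivAt_line_zero {F : Type*} [NormedAddCommGroup F] [NormedSpace ℝ F] {h : ℂ → F}
    {z : ℂ} (w : ℂ) (hh : DifferentiableAt ℝ h z) :
    HasDerivAt (fun s : ℝ => h (z + s • w)) (fderiv ℝ h z w) 0 := by
  simpa using hasDerivAt_line (h := h) (z := z) (w := w) (t := 0) (by simpa using hh)

lemma tendsto_line (z w : ℂ) : Tendsto (fun s : ℝ => z + s • w) (𝓝 0) (𝓝 z) := by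
  have : Continuous fun s : ℝ => z + s • w := by fun_prop
  simpa using this.tendsto 0

lemma differentiableAt_fderiv_apply {F : Type*} [NormedAddCommGroup F] [NormedSpace ℝ F]
    {h : ℂ → F} {z : ℂ} (hh : ContDiffAt ℝ 2 h z) (w : ℂ) :
    DifferentiableAt ℝ (fun y => fderiv ℝ h y w) z :=
  ((hh.fderiv_right (m := 1) (by norm_num)).differentiableAt (by norm_num)).clm_apply
    (differentiableAt_const w)

lemma fderiv_fderiv_apply {F : Type*} [NormedAddCommGroup F] [NormedSpace ℝ F]
    {h : ℂ → F} {z : ℂ} (hh : ContDiffAt ℝ 2 h z) (v w : ℂ) :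
    fderiv ℝ (fun y => fderiv ℝ h y w) z v = fderiv ℝ (fderiv ℝ h) z v w := by
  have hd : DifferentiableAt ℝ (fderiv ℝ h) z :=
    (hh.fderiv_right (m := 1) (by norm_num)).differentiableAt (by norm_num)
  rw [fderiv_clm_apply hd (differentiableAt_const w)]
  simp

/-! ### Lorentzian algebra -/

lemma lorentz_comm (x y : Fin 3 → ℝ) : lorentz x y = lorentz y x := by
  simp only [lorentz]; ring

lemma lorentz_add_left (x y w : Fin 3 → ℝ) : lorentz (x + y) w = lorentz x w + lorentz y w := by
  simp only [lorentz, Pi.add_apply]; ring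

lemma lorentz_smul_right (c : ℝ) (x y : Fin 3 → ℝ) : lorentz x (c • y) = c * lorentz x y := by
  simp only [lorentz, Pi.smul_apply, smul_eq_mul]; ring

lemma lorentz_zero_right (x : Fin 3 → ℝ) : lorentz x 0 = 0 := by simp [lorentz]

/-- The square of the determinant of three vectors is minus their Lorentzian Gram determinant. -/
lemma lorentz_lorentzCross_sq (x a b : Fin 3 → ℝ) :
    lorentz x (lorentzCross a b) ^ 2 =
      -(lorentz x x * (lorentz a a * lorentz b b - lorentz a b ^ 2)
        - lorentz x a * (lorentz x a * lorentz b b - lorentz a b * lorentz x b)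
        + lorentz x b * (lorentz x a * lorentz a b - lorentz a a * lorentz x b)) := by
  simp only [lorentz, lorentzCross, Matrix.cons_val_zero, Matrix.cons_val_one, Matrix.cons_val]
  ring

/-- A vector orthogonal to a nondegenerate pair and to its cross product vanishes. -/
lemma eq_zero_of_lorentz_eq_zero {x a b : Fin 3 → ℝ}
    (hab : lorentz a a * lorentz b b - lorentz a b ^ 2 ≠ 0)
    (ha : lorentz x a = 0) (hb : lorentz x b = 0) (hc : lorentz x (lorentzCross a b) = 0) :
    x = 0 := by
  -- Coordinates of `D x = ⟨x,a⟩ (⟨b,b⟩ a - ⟨a,b⟩ b) + ⟨x,b⟩ (⟨a,a⟩ b - ⟨a,b⟩ a) - ⟨x,a×b⟩ a×b`,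
  -- where `D` is the Gram determinant of `a, b`.
  have key : ∀ i, (lorentz a a * lorentz b b - lorentz a b ^ 2) * x i = 0 := by
    simp only [lorentz, lorentzCross, Matrix.cons_val_zero, Matrix.cons_val_one,
      Matrix.cons_val] at *
    intro i
    fin_cases i <;> simp only [Fin.zero_eta, Fin.mk_one, Fin.reduceFinMk]
    · linear_combination
        (a 0 * (b 0 * b 0 + b 1 * b 1 - b 2 * b 2) - b 0 * (a 0 * b 0 + a 1 * b 1 - a 2 * b 2)) * ha
        + (b 0 * (a 0 * a 0 + a 1 * a 1 - a 2 * a 2) - a 0 * (a 0 * b 0 + a 1 * b 1 - a 2 * b 2))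
          * hb - (a 1 * b 2 - a 2 * b 1) * hc
    · linear_combination
        (a 1 * (b 0 * b 0 + b 1 * b 1 - b 2 * b 2) - b 1 * (a 0 * b 0 + a 1 * b 1 - a 2 * b 2)) * ha
        + (b 1 * (a 0 * a 0 + a 1 * a 1 - a 2 * a 2) - a 1 * (a 0 * b 0 + a 1 * b 1 - a 2 * b 2))
          * hb - (a 2 * b 0 - a 0 * b 2) * hc
    · linear_combination
        (a 2 * (b 0 * b 0 + b 1 * b 1 - b 2 * b 2) - b 2 * (a 0 * b 0 + a 1 * b 1 - a 2 * b 2)) * ha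
        + (b 2 * (a 0 * a 0 + a 1 * a 1 - a 2 * a 2) - a 2 * (a 0 * b 0 + a 1 * b 1 - a 2 * b 2))
          * hb + (a 0 * b 1 - a 1 * b 0) * hc
  exact funext fun i => (mul_eq_zero.1 (key i)).resolve_left hab

lemma hasDerivAt_lorentz {x y : ℝ → Fin 3 → ℝ} {x' y' : Fin 3 → ℝ} {t : ℝ}
    (hx : HasDerivAt x x' t) (hy : HasDerivAt y y' t) :
    HasDerivAt (fun s => lorentz (x s) (y s)) (lorentz x' (y t) + lorentz (x t) y') t := by
  have hx := hasDerivAt_pi.1 hx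
  have hy := hasDerivAt_pi.1 hy
  have h := (((hx 0).mul (hy 0)).add ((hx 1).mul (hy 1))).sub ((hx 2).mul (hy 2))
  refine h.congr_deriv ?_
  simp only [lorentz]; ring

lemma continuous_lorentz_self : Continuous fun x : Fin 3 → ℝ => lorentz x x := by
  unfold lorentz; fun_prop

/-! ### Conformal maximal surfaces have harmonic coordinates -/

lemma dV_dU_eq_dU_dV {Y : ℂ → Fin 3 → ℝ} {z : ℂ} (hY : ContDiffAt ℝ 2 Y z) :
    dV (dU Y) z = dU (dV Y) z := by
  change fderiv ℝ (fun y => fderiv ℝ Y y 1) z Complex.I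
    = fderiv ℝ (fun y => fderiv ℝ Y y Complex.I) z 1
  rw [fderiv_fderiv_apply hY, fderiv_fderiv_apply hY]
  exact hY.isSymmSndFDerivAt (by simp) _ _

lemma hasDerivAt_lorentz_line {A B : ℂ → Fin 3 → ℝ} {z : ℂ} (w : ℂ)
    (hA : DifferentiableAt ℝ A z) (hB : DifferentiableAt ℝ B z) :
    HasDerivAt (fun s : ℝ => lorentz (A (z + s • w)) (B (z + s • w)))
      (lorentz (fderiv ℝ A z w) (B z) + lorentz (A z) (fderiv ℝ B z w)) 0 := by
  simpa using hasDerivAt_lorentz (hasDerivAt_line_zero w hA) (hasDerivAt_line_zero w hB)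

/-- Differentiating `E = G` and `F = 0` makes `ΔY` orthogonal to both tangent vectors; in isothermal
parameters zero mean curvature kills the normal component. -/
lemma laplacian_eq_zero {Y : ℂ → Fin 3 → ℝ} {z : ℂ} (hY : ContDiffAt ℝ 2 Y z)
    (hs : SpacelikeAt Y z) (hconf : ∀ᶠ y in 𝓝 z, IsothermalAt Y y)
    (hmc : meanCurvature Y z = 0) : dU (dU Y) z + dV (dV Y) z = 0 := by
  have dfU : DifferentiableAt ℝ (dU Y) z := differentiableAt_fderiv_apply hY 1
  have dfV : DifferentiableAt ℝ (dV Y) z := differentiableAt_fderiv_apply hY Complex.I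
  have hsymm := dV_dU_eq_dU_dV hY
  obtain ⟨hE, hF⟩ := hconf.self_of_nhds
  have hpos : 0 < lorentz (dU Y z) (dU Y z) := hs 1 one_ne_zero
  have diffE : ∀ w : ℂ, lorentz (fderiv ℝ (dU Y) z w) (dU Y z)
      = lorentz (fderiv ℝ (dV Y) z w) (dV Y z) := by
    intro w
    have h1 := hasDerivAt_lorentz_line w dfU dfU
    have h2 := hasDerivAt_lorentz_line w dfV dfV
    have h3 := h1.unique (h2.congr_of_eventuallyEq
      (((tendsto_line z w).eventually hconf).mono fun s hs => hs.1))
    rw [lorentz_comm (dU Y z), lorentz_comm (dV Y z)] at h3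
    linarith
  have diffF : ∀ w : ℂ, lorentz (fderiv ℝ (dU Y) z w) (dV Y z)
      + lorentz (fderiv ℝ (dV Y) z w) (dU Y z) = 0 := by
    intro w
    have h1 := hasDerivAt_lorentz_line w dfU dfV
    have h3 := h1.unique ((hasDerivAt_const (0 : ℝ) (0 : ℝ)).congr_of_eventuallyEq
      (((tendsto_line z w).eventually hconf).mono fun s hs => hs.2))
    rwa [lorentz_comm (dU Y z)] at h3
  have hdet : firstDet Y z = lorentz (dU Y z) (dU Y z) ^ 2 := by
    rw [firstDet, ← hE, hF]; ring
  have eU1 : lorentz (dU (dU Y) z) (dU Y z) = lorentz (dU (dV Y) z) (dV Y z) := diffE 1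
  have eV1 : lorentz (dV (dU Y) z) (dU Y z) = lorentz (dV (dV Y) z) (dV Y z) := diffE Complex.I
  have eU2 : lorentz (dU (dU Y) z) (dV Y z) + lorentz (dU (dV Y) z) (dU Y z) = 0 := diffF 1
  have eV2 : lorentz (dV (dU Y) z) (dV Y z) + lorentz (dV (dV Y) z) (dU Y z) = 0 :=
    diffF Complex.I
  rw [hsymm] at eV1 eV2
  refine eq_zero_of_lorentz_eq_zero (a := dU Y z) (b := dV Y z) ?_ ?_ ?_ ?_
  · change firstDet Y z ≠ 0
    rw [hdet]; positivity
  · rw [lorentz_add_left]; linarith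
  · rw [lorentz_add_left]; linarith
  · have hden : (2 * firstDet Y z) ≠ 0 := by rw [hdet]; positivity
    have h := (div_eq_zero_iff.1 hmc).resolve_right hden
    rw [hF, ← hE, unitNormal, lorentz_smul_right, lorentz_smul_right, lorentz_smul_right] at h
    have hsq : (Real.sqrt (firstDet Y z))⁻¹ ≠ 0 := by
      rw [hdet, Real.sqrt_sq hpos.le]; positivity
    have h' : (Real.sqrt (firstDet Y z))⁻¹ * lorentz (dU Y z) (dU Y z)
        * lorentz (dU (dU Y) z + dV (dV Y) z) (lorentzCross (dU Y z) (dV Y z)) = 0 := by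
      rw [lorentz_add_left]; linear_combination h
    exact (mul_eq_zero.1 h').resolve_left (mul_ne_zero hsq hpos.ne')

/-! ### A strictly superharmonic function of the Lorentzian norm -/

/-- Second order condition along a line at a local maximum of `F - ε log (⟨Y, Y⟩ - 1)`. -/
lemma second_deriv_sub_log_nonpos {Y : ℂ → Fin 3 → ℝ} {F : ℂ → ℝ} {z : ℂ} {ε : ℝ}
    (hY : ContDiffAt ℝ 2 Y z) (hF : ContDiffAt ℝ 2 F z) (hn : 1 < lorentz (Y z) (Y z))
    (hmax : IsLocalMax (fun y => F y - ε * Real.log (lorentz (Y y) (Y y) - 1)) z) (w : ℂ) :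
    fderiv ℝ (fun y => fderiv ℝ F y w) z w
      - ε * (2 * (lorentz (fderiv ℝ (fun y => fderiv ℝ Y y w) z w) (Y z)
            + lorentz (fderiv ℝ Y z w) (fderiv ℝ Y z w)) / (lorentz (Y z) (Y z) - 1)
          - 4 * lorentz (fderiv ℝ Y z w) (Y z) ^ 2 / (lorentz (Y z) (Y z) - 1) ^ 2) ≤ 0 := by
  have hcont : ContinuousAt (fun y => lorentz (Y y) (Y y)) z :=
    continuous_lorentz_self.continuousAt.comp hY.continuousAt
  have hev : ∀ᶠ y in 𝓝 z, DifferentiableAt ℝ Y y ∧ DifferentiableAt ℝ F y ∧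
      1 < lorentz (Y y) (Y y) := by
    filter_upwards [hY.eventually (by simp), hF.eventually (by simp),
      hcont.eventually (lt_mem_nhds hn)] with y h1 h2 h3
    exact ⟨h1.differentiableAt two_ne_zero, h2.differentiableAt two_ne_zero, h3⟩
  have hev' := (tendsto_line z w).eventually hev
  refine second_deriv_nonpos_of_isLocalMax (t := 0)
    (g := fun s : ℝ => F (z + s • w) - ε * Real.log (lorentz (Y (z + s • w)) (Y (z + s • w)) - 1))
    (g' := fun s : ℝ => fderiv ℝ F (z + s • w) w
      - ε * (2 * lorentz (fderiv ℝ Y (z + s • w) w) (Y (z + s • w))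
        / (lorentz (Y (z + s • w)) (Y (z + s • w)) - 1))) ?_ ?_ ?_
  · filter_upwards [hev'] with s ⟨h1, h2, h3⟩
    have hl := (hasDerivAt_lorentz (hasDerivAt_line h1) (hasDerivAt_line h1)).sub_const 1
    refine ((hasDerivAt_line h2).sub ((hl.log (by linarith)).const_mul ε)).congr_deriv ?_
    rw [lorentz_comm (Y (z + s • w))]
    ring
  · have hdY := hY.differentiableAt two_ne_zero
    have hl := (hasDerivAt_lorentz_line w hdY hdY).sub_const 1
    have hnum := (hasDerivAt_lorentz_line w (differentiableAt_fderiv_apply hY w) hdY).const_mul 2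
    have hq := hnum.div hl (by simp only [zero_smul, add_zero]; linarith)
    refine ((hasDerivAt_line_zero w (differentiableAt_fderiv_apply hF w)).sub
      (hq.const_mul ε)).congr_deriv ?_
    have hne : lorentz (Y z) (Y z) - 1 ≠ 0 := by linarith
    simp only [zero_smul, add_zero]
    rw [lorentz_comm (Y z) (fderiv ℝ Y z w)]
    field_simp
    ring
  · have := (tendsto_line z w).eventually hmax
    simpa [IsLocalMax, IsMaxFilter] using this

/-- On a conformal maximal surface, `-log (⟨Y, Y⟩ - 1)` is strictly subharmonic where
`⟨Y, Y⟩ > 1`, so adding a positive multiple of it to a harmonic function leaves no local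
maximum. -/
lemma not_isLocalMax_sub_log {Y : ℂ → Fin 3 → ℝ} {F : ℂ → ℝ} {z : ℂ} {ε : ℝ} (hε : 0 < ε)
    (hY : ContDiffAt ℝ 2 Y z) (hs : SpacelikeAt Y z) (hconf : ∀ᶠ y in 𝓝 z, IsothermalAt Y y)
    (hmc : meanCurvature Y z = 0) (hF : InnerProductSpace.HarmonicAt F z)
    (hn : 1 < lorentz (Y z) (Y z)) :
    ¬ IsLocalMax (fun y => F y - ε * Real.log (lorentz (Y y) (Y y) - 1)) z := by
  intro hmax
  have h1 := second_deriv_sub_log_nonpos hY hF.1 hn hmax 1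
  have h2 := second_deriv_sub_log_nonpos hY hF.1 hn hmax Complex.I
  have hΔF : fderiv ℝ (fun y => fderiv ℝ F y 1) z 1
      + fderiv ℝ (fun y => fderiv ℝ F y Complex.I) z Complex.I = 0 := by
    rw [fderiv_fderiv_apply hF.1, fderiv_fderiv_apply hF.1]
    have := hF.2.self_of_nhds
    simpa [InnerProductSpace.laplacian_eq_iteratedFDeriv_complexPlane,
      iteratedFDeriv_two_apply] using this
  have hΔY := congrArg (fun x => lorentz x (Y z)) (laplacian_eq_zero hY hs hconf hmc)
  simp only [lorentz_add_left, lorentz_comm 0, lorentz_zero_right] at hΔY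
  obtain ⟨hE, hFF⟩ := hconf.self_of_nhds
  have hpos : 0 < lorentz (dU Y z) (dU Y z) := hs 1 one_ne_zero
  have hgram := lorentz_lorentzCross_sq (Y z) (dU Y z) (dV Y z)
  change fderiv ℝ (fun y => fderiv ℝ F y 1) z 1
      - ε * (2 * (lorentz (dU (dU Y) z) (Y z) + lorentz (dU Y z) (dU Y z))
        / (lorentz (Y z) (Y z) - 1)
          - 4 * lorentz (dU Y z) (Y z) ^ 2 / (lorentz (Y z) (Y z) - 1) ^ 2) ≤ 0 at h1
  change fderiv ℝ (fun y => fderiv ℝ F y Complex.I) z Complex.I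
      - ε * (2 * (lorentz (dV (dV Y) z) (Y z) + lorentz (dV Y z) (dV Y z))
        / (lorentz (Y z) (Y z) - 1)
          - 4 * lorentz (dV Y z) (Y z) ^ 2 / (lorentz (Y z) (Y z) - 1) ^ 2) ≤ 0 at h2
  rw [hFF, ← hE, lorentz_comm (Y z) (dU Y z), lorentz_comm (Y z) (dV Y z)] at hgram
  rw [← hE] at h2
  generalize lorentz (Y z) (Y z) = n at *
  generalize lorentz (dU Y z) (dU Y z) = l at *
  generalize lorentz (dU Y z) (Y z) = p at *
  generalize lorentz (dV Y z) (Y z) = q at *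
  -- By `hgram`, `l (p² + q² - l n)` is the square of a determinant. This is where the Lorentzian
  -- signature enters.
  have hgrad : l * n ≤ p ^ 2 + q ^ 2 := by
    have : 0 ≤ l * (p ^ 2 + q ^ 2 - l * n) := by
      refine (sq_nonneg _).trans_eq (hgram.trans ?_); ring
    have := nonneg_of_mul_nonneg_right this hpos
    linarith
  have hn' : 0 < n - 1 := by linarith
  have hsum : ε * (4 * l / (n - 1) - 4 * (p ^ 2 + q ^ 2) / (n - 1) ^ 2) ≥ 0 := by
    have : ε * (4 * l / (n - 1) - 4 * (p ^ 2 + q ^ 2) / (n - 1) ^ 2)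
      = ε * (2 * (lorentz (dU (dU Y) z) (Y z) + l) / (n - 1) - 4 * p ^ 2 / (n - 1) ^ 2)
        + ε * (2 * (lorentz (dV (dV Y) z) (Y z) + l) / (n - 1) - 4 * q ^ 2 / (n - 1) ^ 2) := by
      rw [eq_neg_of_add_eq_zero_left hΔY]; ring
    linarith
  -- Strictness comes from the shift by one: `l (n - 1) < l n ≤ p² + q²`.
  have hneg : 4 * l / (n - 1) - 4 * (p ^ 2 + q ^ 2) / (n - 1) ^ 2 < 0 := by
    rw [sub_neg, div_lt_div_iff₀ hn' (by positivity)]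
    have : 4 * (p ^ 2 + q ^ 2) * (n - 1) > 4 * l * (n - 1) * (n - 1) := by
      apply mul_lt_mul_of_pos_right _ hn'
      nlinarith
    nlinarith
  exact absurd hsum (not_le.2 (mul_neg_of_pos_of_neg hε hneg))

/-- The local strong maximum principle for harmonic functions in the plane. -/
lemma eventually_eq_of_harmonicAt_of_isLocalMax {F : ℂ → ℝ} {z : ℂ}
    (hF : InnerProductSpace.HarmonicAt F z) (hmax : IsLocalMax F z) :
    ∀ᶠ y in 𝓝 z, F y = F z := by
  obtain ⟨r, hr, hball⟩ := Metric.eventually_nhds_iff_ball.1 hF.eventually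
  obtain ⟨G, hG, hre⟩ := InnerProductSpace.HarmonicOnNhd.exists_analyticOnNhd_ball_re_eq
    (f := F) (z := z) (R := r) hball
  have hnear : ∀ᶠ y in 𝓝 z, y ∈ Metric.ball z r := Metric.ball_mem_nhds z hr
  have hz := Metric.mem_ball_self (x := z) hr
  -- With `F = Re G`, `|exp G| = exp F`, so the maximum modulus principle applies to `exp G`.
  have hnorm : ∀ y ∈ Metric.ball z r, ‖Complex.exp (G y)‖ = Real.exp (F y) := fun y hy => by
    rw [Complex.norm_exp]; exact congrArg Real.exp (hre hy)
  have key := Complex.norm_eventually_eq_of_isLocalMax (f := fun y => Complex.exp (G y)) (c := z)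
    (hnear.mono fun y hy => (hG y hy).differentiableAt.cexp) (by
      filter_upwards [hnear, hmax] with y hy hle
      simp only [Function.comp_apply, hnorm y hy, hnorm z hz]
      exact Real.exp_le_exp.2 hle)
  filter_upwards [hnear, key] with y hy h
  rw [hnorm y hy, hnorm z hz] at h
  exact Real.exp_injective h

/-! ### Maximum principles on the surface -/

section Surface

variable {S : Type*} [TopologicalSpace S]

lemma IsSurfaceWithBoundary.isOpen_diff {M bd : Set S} (hM : IsSurfaceWithBoundary M bd) :
    IsOpen (M \ bd) := by
  have : M \ bd = interior M \ bd := by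
    refine Subset.antisymm (fun p hp => ⟨?_, hp.2⟩) fun p hp => ⟨interior_subset hp.1, hp.2⟩
    by_contra hint
    exact hp.2 (hM.frontier_subset ⟨subset_closure hp.1, hint⟩)
  rw [this]
  exact isOpen_interior.sdiff hM.isClosed_bd

/-- A function that is proper on `M`, continuous, and positive off a compact set has compact
sublevel sets. -/
lemma isCompact_sublevel {M K : Set S} {n : S → ℝ} (hn : ContinuousOn n M) (hK : IsCompact K)
    (hKM : K ⊆ M) (hpos : ∀ p ∈ M \ K, 0 < n p) (hproper : IsProperMap fun p : M => n p) (R : ℝ) :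
    IsCompact {p ∈ M | n p ≤ R} := by
  -- Properness needs a compact interval, so `n` must be bounded below: by `B` on `K`, by zero off
  -- `K`.
  obtain ⟨B, hB⟩ := (hK.image_of_continuousOn (hn.mono hKM)).bddBelow
  have hc : IsCompact ((fun p : M => n p) ⁻¹' Icc (min B 0) R) :=
    hproper.isCompact_preimage isCompact_Icc
  convert hc.image continuous_subtype_val using 1
  ext p
  constructor
  · rintro ⟨hp, hpR⟩
    refine ⟨⟨p, hp⟩, ⟨?_, hpR⟩, rfl⟩
    by_cases hpK : p ∈ K
    · exact (min_le_left _ _).trans (hB ⟨p, hpK, rfl⟩)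
    · exact (min_le_right _ _).trans (hpos p ⟨hp, hpK⟩).le
  · rintro ⟨⟨p, hp⟩, ⟨-, hpR⟩, rfl⟩
    exact ⟨hp, hpR⟩

variable [ChartedSpace ℂ S]

lemma isLocalMax_comp_chart_symm {g : S → ℝ} {q : S} (h : IsLocalMax g q) :
    IsLocalMax (g ∘ (chartAt ℂ q).symm) (chartAt ℂ q q) := by
  have ht : Tendsto (chartAt ℂ q).symm (𝓝 (chartAt ℂ q q)) (𝓝 q) := by
    simpa [ContinuousAt] using (chartAt ℂ q).symm.continuousAt (x := chartAt ℂ q q) (by simp)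
  filter_upwards [ht.eventually h] with y hy
  simpa using hy

lemma HarmonicOn.neg {f : S → ℝ} {U : Set S} (hf : HarmonicOn f U) : HarmonicOn (-f) U :=
  fun φ hφ => InnerProductSpace.HarmonicOnNhd.neg (hf φ hφ)

lemma mem_chart_domain {U : Set S} {q : S} (hq : q ∈ U) :
    chartAt ℂ q q ∈ (chartAt ℂ q).target ∩ (chartAt ℂ q).symm ⁻¹' U := by
  simp [hq]

/-- The local strong maximum principle on a Riemann surface. -/
lemma HarmonicOn.eventually_eq_of_isLocalMax {f : S → ℝ} {U : Set S} (hf : HarmonicOn f U) {q : S}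
    (hq : q ∈ U) (hmax : IsLocalMax f q) : ∀ᶠ p in 𝓝 q, f p = f q := by
  have h := eventually_eq_of_harmonicAt_of_isLocalMax
    (hf _ (chart_mem_atlas ℂ q) _ (mem_chart_domain hq)) (isLocalMax_comp_chart_symm hmax)
  have hsrc := (chartAt ℂ q).open_source.mem_nhds (mem_chart_source ℂ q)
  filter_upwards [((chartAt ℂ q).continuousAt (mem_chart_source ℂ q)).eventually h, hsrc]
    with p hp hps
  simpa [(chartAt ℂ q).left_inv hps] using hp

lemma IsConformalMaximalImmersion.not_isLocalMax {M bd : Set S} {X : S → Fin 3 → ℝ}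
    (hM : IsSurfaceWithBoundary M bd) (hX : IsConformalMaximalImmersion M bd X) {f : S → ℝ}
    (hf : HarmonicOn f (M \ bd)) {q : S} (hq : q ∈ M \ bd) (hn : 1 < lorentzNorm X q) {ε : ℝ}
    (hε : 0 < ε) : ¬ IsLocalMax (fun p => f p - ε * Real.log (lorentzNorm X p - 1)) q := by
  intro hmax
  have hφ := chart_mem_atlas ℂ q
  have hz := mem_chart_domain hq
  have hopen : IsOpen ((chartAt ℂ q).target ∩ (chartAt ℂ q).symm ⁻¹' (M \ bd)) :=
    (chartAt ℂ q).isOpen_inter_preimage_symm hM.isOpen_diff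
  refine not_isLocalMax_sub_log hε
    (((hX.smooth _ hφ).contDiffAt (hopen.mem_nhds hz)).of_le
      (WithTop.coe_le_coe.2 (le_top : (2 : ℕ∞) ≤ ⊤)))
    (hX.spacelike _ hφ _ hz)
    (Filter.mem_of_superset (hopen.mem_nhds hz) fun y hy => hX.conformal _ hφ y hy)
    (hX.maximal _ hφ _ hz) (hf _ hφ _ hz) ?_ (isLocalMax_comp_chart_symm hmax)
  simpa [lorentzNorm] using hn

/-- A bounded harmonic function that vanishes on the boundary is controlled by its values on the
compact set where the Lorentzian norm is at most `2`. -/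
lemma IsConformalMaximalImmersion.le_of_le_on_sublevel {M bd : Set S} {X : S → Fin 3 → ℝ}
    (hM : IsSurfaceWithBoundary M bd) (hX : IsConformalMaximalImmersion M bd X)
    (hcpt : ∀ R, IsCompact {p ∈ M | lorentzNorm X p ≤ R})
    {f : S → ℝ} (hfc : ContinuousOn f M) (hf : HarmonicOn f (M \ bd)) {C : ℝ}
    (hC : ∀ p ∈ M, f p ≤ C) (hbd : ∀ p ∈ bd, f p = 0) {a : ℝ} (ha : 0 ≤ a)
    (hfa : ∀ p ∈ M, lorentzNorm X p ≤ 2 → f p ≤ a) : ∀ p ∈ M, f p ≤ a := by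
  intro p hp
  rcases le_or_gt (lorentzNorm X p) 2 with hp2 | hp2
  · exact hfa p hp hp2
  set n := lorentzNorm X with hn_def
  have hnc : ContinuousOn n M := continuous_lorentz_self.comp_continuousOn hX.continuousOn
  have hlogp : 0 < Real.log (n p - 1) := Real.log_pos (by linarith)
  suffices h : ∀ ε : ℝ, 0 < ε → f p - ε * Real.log (n p - 1) ≤ a by
    refine le_of_forall_pos_le_add fun δ hδ => ?_
    have := h (δ / Real.log (n p - 1)) (by positivity)
    rw [div_mul_cancel₀ _ hlogp.ne'] at this
    linarith
  intro ε hε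
  by_contra! hgt
  set g : S → ℝ := fun p => f p - ε * Real.log (n p - 1) with hg
  -- Large enough that `p` lies in the region `2 ≤ n ≤ R` and that `f - ε log (n - 1)` is negative
  -- on `n = R`.
  set R := n p + 1 + Real.exp ((|C| + 1) / ε) with hR
  have hexp := Real.exp_pos ((|C| + 1) / ε)
  have hRlog : C < ε * Real.log (R - 1) := by
    have : (|C| + 1) / ε ≤ Real.log (R - 1) := by
      rw [Real.le_log_iff_exp_le (by linarith)]; linarith
    rw [div_le_iff₀' hε] at this
    linarith [le_abs_self C]
  have hT : IsCompact ({p ∈ M | n p ≤ R} ∩ {p ∈ M | 2 ≤ n p}) := by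
    refine (hcpt R).inter_right ?_
    exact hnc.preimage_isClosed_of_isClosed hM.isClosed isClosed_Ici
  have hgc : ContinuousOn g ({p ∈ M | n p ≤ R} ∩ {p ∈ M | 2 ≤ n p}) := by
    have hsub : {p ∈ M | n p ≤ R} ∩ {p ∈ M | 2 ≤ n p} ⊆ M := fun x hx => hx.1.1
    refine (hfc.mono hsub).sub (continuousOn_const.mul
      (((hnc.mono hsub).sub continuousOn_const).log fun x hx => ?_))
    have : 2 ≤ n x := hx.2.2
    exact (by linarith : n x - 1 ≠ 0)
  obtain ⟨q, ⟨⟨hqM, hqR⟩, -, hq2⟩, hqmax⟩ :=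
    hT.exists_isMaxOn ⟨p, ⟨hp, by linarith⟩, hp, hp2.le⟩ hgc
  have hgq : a < g q := hgt.trans_le (hqmax (a := p) ⟨⟨hp, by linarith⟩, hp, hp2.le⟩)
  -- The maximum point avoids `n = 2`, where the logarithm vanishes and `g = f ≤ a`, then `n = R`,
  -- then `bd`, where `g < 0`. It is thus an interior local maximum.
  have hq2' : 2 < n q := by
    refine hq2.lt_of_ne fun h => ?_
    have hone : (2 : ℝ) - 1 = 1 := by norm_num
    have : g q = f q := by simp [hg, ← h, hone]
    linarith [hfa q hqM h.ge]
  have hqR' : n q < R := by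
    refine hqR.lt_of_ne fun h => ?_
    have : g q = f q - ε * Real.log (R - 1) := by simp only [hg, h]
    linarith [hC q hqM]
  have hqbd : q ∉ bd := fun h => by
    have h1 : g q = f q - ε * Real.log (n q - 1) := rfl
    have h2 : 0 < ε * Real.log (n q - 1) := mul_pos hε (Real.log_pos (by linarith))
    linarith [hbd q h]
  refine hX.not_isLocalMax hM hf ⟨hqM, hqbd⟩ (by linarith : 1 < n q) hε ?_
  have hnear := hM.isOpen_diff.mem_nhds ⟨hqM, hqbd⟩
  have hncq : ContinuousAt n q :=
    hnc.continuousAt (Filter.mem_of_superset hnear fun x hx => hx.1)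
  filter_upwards [hnear, hncq.eventually (lt_mem_nhds hq2'), hncq.eventually (gt_mem_nhds hqR')]
    with x hx h2 hR
  exact hqmax ⟨⟨hx.1, hR.le⟩, hx.1, h2.le⟩

/-- A harmonic function that vanishes on the non-empty boundary has no positive maximum. -/
lemma HarmonicOn.nonpos_of_isMaxOn [ConnectedSpace S] {M bd : Set S}
    (hM : IsSurfaceWithBoundary M bd) (hne : bd.Nonempty) {f : S → ℝ} (hfc : ContinuousOn f M)
    (hf : HarmonicOn f (M \ bd)) (hbd : ∀ p ∈ bd, f p = 0) {q : S} (hq : q ∈ M)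
    (hmax : IsMaxOn f M q) : f q ≤ 0 := by
  by_contra! hpos
  -- The set where the positive maximum is attained misses `bd`, so it is clopen in the connected
  -- surface `S`; it would then be all of `S`, including `bd`.
  have hclosed : IsClosed {p ∈ M | f p = f q} :=
    hfc.preimage_isClosed_of_isClosed hM.isClosed (isClosed_singleton (x := f q))
  have hopen : IsOpen {p ∈ M | f p = f q} := by
    rw [isOpen_iff_mem_nhds]
    rintro p ⟨hp, hpq⟩
    have hpbd : p ∉ bd := fun h => by
      have := hbd p h
      linarith
    have hnear := hM.isOpen_diff.mem_nhds ⟨hp, hpbd⟩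
    have hloc : IsLocalMax f p := by
      filter_upwards [hnear] with x hx
      exact (hmax hx.1).trans_eq hpq.symm
    filter_upwards [hnear, hf.eventually_eq_of_isLocalMax ⟨hp, hpbd⟩ hloc] with x hx h
    exact ⟨hx.1, h.trans hpq⟩
  have huniv := IsClopen.eq_univ ⟨hclosed, hopen⟩ ⟨q, hq, rfl⟩
  obtain ⟨b, hb⟩ := hne
  have hbq : b ∈ {p ∈ M | f p = f q} := huniv ▸ mem_univ b
  linarith [hbd b hb, hbq.2]

/-- A positive value on the compact set `n ≤ 2` would make the maximum of `f` there a maximum over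
all of `M`; otherwise the comparison applies with `a = 0`. -/
lemma IsConformalMaximalImmersion.nonpos [ConnectedSpace S] {M bd : Set S} {X : S → Fin 3 → ℝ}
    (hM : IsSurfaceWithBoundary M bd) (hne : bd.Nonempty)
    (hX : IsConformalMaximalImmersion M bd X)
    (hcpt : ∀ R, IsCompact {p ∈ M | lorentzNorm X p ≤ R})
    {f : S → ℝ} (hfc : ContinuousOn f M) (hf : HarmonicOn f (M \ bd)) {C : ℝ}
    (hC : ∀ p ∈ M, f p ≤ C) (hbd : ∀ p ∈ bd, f p = 0) : ∀ p ∈ M, f p ≤ 0 := by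
  have hle := fun a => hX.le_of_le_on_sublevel hM hcpt hfc hf hC hbd (a := a)
  by_cases h : ∀ p ∈ M, lorentzNorm X p ≤ 2 → f p ≤ 0
  · exact hle 0 le_rfl h
  · push Not at h
    obtain ⟨p, hpM, hp2, hp⟩ := h
    obtain ⟨q, ⟨hqM, -⟩, hqmax⟩ :=
      (hcpt 2).exists_isMaxOn ⟨p, hpM, hp2⟩ (hfc.mono fun x hx => hx.1)
    have hpq : f p ≤ f q := hqmax ⟨hpM, hp2⟩
    have hmax : IsMaxOn f M q := hle (f q) (by linarith) fun x hx hx2 => hqmax ⟨hx, hx2⟩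
    linarith [hf.nonpos_of_isMaxOn hM hne hfc hbd hqM hmax]

end Surface

end LorentzSurface

theorem mainTheorem1 {S : Type*} [TopologicalSpace S] [T2Space S] [ConnectedSpace S]
    [ChartedSpace ℂ S] [IsManifold 𝓘(ℂ) 1 S]
    (M bd : Set S) (hM : LorentzSurface.IsSurfaceWithBoundary M bd) (hbd : bd.Nonempty)
    (X : S → Fin 3 → ℝ) (hX : LorentzSurface.IsConformalMaximalImmersion M bd X)
    (hpos : ∃ K : Set S, IsCompact K ∧ K ⊆ M ∧ ∀ p ∈ M \ K, 0 < LorentzSurface.lorentzNorm X p)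
    (hproper : IsProperMap (fun p : M => LorentzSurface.lorentzNorm X (p : S))) :
    LorentzSurface.RelativeParabolic M bd := by
  intro f hfc hf ⟨C, hC⟩ hf0 p hp
  obtain ⟨K, hK, hKM, hKpos⟩ := hpos
  have hcpt := LorentzSurface.isCompact_sublevel
    (LorentzSurface.continuous_lorentz_self.comp_continuousOn hX.continuousOn) hK hKM hKpos hproper
  have h1 := hX.nonpos hM hbd hcpt hfc hf (fun p hp => (abs_le.1 (hC p hp)).2) hf0 p hp
  have h2 := hX.nonpos hM hbd hcpt hfc.neg hf.neg (C := C)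
    (fun p hp => by simpa using neg_le.1 (abs_le.1 (hC p hp)).1)
    (fun p hp => by simpa using hf0 p hp) p hp
  simp only [Pi.neg_apply] at h2
  linarith
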